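/- Lemma 3.2. Let $D$ be a closed (orientable, connected) discrete surface of genus $g\ge 0$: a finite cell complex whose faces are polygons bounded by simple closed curves of a finite simple graph, in which every edge lies on exactly two faces and the link of every vertex is a cycle. Let $J$ be a set of sample vertices of $D$, let $A_1<\dots<A_n$ be real levels, and let a family of gradually varied paths be given in the graph of $D$, passing through all points of $J$ (that is, values are assigned to the vertices so that adjacent vertices of a path have levels $A_i,A_j$ with $|i-j|\le 1$). Let $\Gamma$ be the union of the paths, as a graph, and suppose that each vertex of $\Gamma$ has two neighbours in $\Gamma$ (exactly two; more than two, as happens where several closed paths meet, are allowed in the first part of the conclusion). Then the paths are the boundary of several manifolds: there are finitely many (at least one) compact connected discrete surfaces $M_i$, possibly with boundary, and a gluing map $\varphi:\bigsqcup_i M_i\to D$ taking vertices, edges and faces to vertices, edges and faces, such that * every face of $D$ is the image of exactly one face, the boundary cycle of each face being mapped isomorphically, and $\varphi$ is injective on the neighbours of each vertex; * every vertex and every edge of $D$ not in $\Gamma$ is the image of exactly one vertex, respectively edge; * the boundary of $\bigsqcup_i M_i$ is exactly the preimage of $\Gamma$; every edge of $\Gamma$ is the image of exactly two boundary edges, and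 every vertex of $\Gamma$ with $d$ neighbours in $\Gamma$ is the image of exactly $d$ boundary vertices. If moreover each vertex of $\Gamma$ has exactly two neighbours in $\Gamma$, then $\varphi$ is injective on every boundary curve of every $M_i$, so each boundary curve is mapped isomorphically onto one of the closed curves that make up $\Gamma$. -/

import Mathlib

universe u

/-- A compact connected discrete surface, possibly with boundary: a finite two-dimensional cell
complex whose faces are polygons (triangulations and cubical surfaces are special cases).
Its one-skeleton is the graph `G`. Each face is bounded by a simple closed curve of `G`, every edge
lies on one or two faces, and the link of every vertex is connected. The link of `v` has the
edges at `v` as nodes and the faces at `v` as arcs; a node lies on one or two arcs, so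
connectedness says that the link is a simple path or a simple cycle. -/
structure DiscreteSurface where
  V : Type u
  F : Type u
  finite_V : Finite V
  finite_F : Finite F
  nonempty_F : Nonempty F
  G : SimpleGraph V
  connected : G.Connected
  face : F → G.Subgraph
  face_connected : ∀ f, (face f).Connected
  face_regular : ∀ f, ∀ v ∈ (face f).verts, ((face f).neighborSet v).ncard = 2
  edge_faces : ∀ v w, G.Adj v w →
    {f | (face f).Adj v w}.ncard = 1 ∨ {f | (face f).Adj v w}.ncard = 2
  link_connected : ∀ v a b, G.Adj v a → G.Adj v b →
    Relation.ReflTransGen (fun x y => ∃ f, (face f).Adj v x ∧ (face f).Adj v y) a b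

namespace DiscreteSurface

/-- The boundary of the surface: the graph of all edges that lie on exactly one face.
(Its non-isolated vertices are the boundary vertices, i.e. those whose link is a path;
each of them has exactly two boundary edges, so the boundary is a disjoint union of simple
closed curves.) -/
def boundary (S : DiscreteSurface.{u}) : SimpleGraph S.V where
  Adj v w := S.G.Adj v w ∧ {f | (S.face f).Adj v w}.ncard = 1
  symm := ⟨by
    rintro v w ⟨h, h1⟩
    refine ⟨h.symm, ?_⟩
    simpa only [SimpleGraph.Subgraph.adj_comm] using h1⟩
  loopless := ⟨fun v h => S.G.loopless.irrefl v h.1⟩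

/-- A closed surface has no boundary: every edge lies on exactly two faces. -/
def IsClosed (S : DiscreteSurface.{u}) : Prop :=
  ∀ v w, S.G.Adj v w → {f | (S.face f).Adj v w}.ncard = 2

/-- Every boundary cycle of a face can be directed (`o f v w`: the edge `vw` of `f` is directed
from `v` to `w`) so that any two faces with a common edge direct it oppositely. -/
def Orientable (S : DiscreteSurface.{u}) : Prop :=
  ∃ o : S.F → S.V → S.V → Prop,
    (∀ f v w, (S.face f).Adj v w ↔ (o f v w ∨ o f w v)) ∧
    (∀ f v w, o f v w → ¬ o f w v) ∧
    (∀ f, ∀ v ∈ (S.face f).verts, ∃! w, o f v w) ∧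
    (∀ f f' v w, f ≠ f' → o f v w → (S.face f').Adj v w → o f' w v)

/-- The Euler characteristic: vertices minus edges plus faces. -/
noncomputable def eulerChar (S : DiscreteSurface.{u}) : ℤ :=
  (Nat.card S.V : ℤ) - (Nat.card S.G.edgeSet : ℤ) + (Nat.card S.F : ℤ)

/-- A closed orientable surface of genus `g`. -/
def IsClosedOfGenus (S : DiscreteSurface.{u}) (g : ℕ) : Prop :=
  S.IsClosed ∧ S.Orientable ∧ S.eulerChar = 2 - 2 * (g : ℤ)

/-- `S` is cut along the graph `Γ` into the surfaces with boundary `M i`: `S` is the disjoint union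
of the `M i` with boundary edges and boundary vertices glued together, `φ` and `ψ` are the gluing
maps on vertices and on faces, and `Γ` is what the boundaries of the `M i` are glued to. -/
structure IsCutAlong (S : DiscreteSurface.{u}) (Γ : S.G.Subgraph) {ι : Type u}
    (M : ι → DiscreteSurface.{u}) (φ : ∀ i, (M i).V → S.V) (ψ : ∀ i, (M i).F → S.F) : Prop where
  /-- The faces of `S` are partitioned among the pieces. -/
  face_bijective : Function.Bijective (fun x : Σ i, (M i).F => ψ x.1 x.2)
  /-- The boundary cycle of a face is mapped isomorphically. -/
  face_verts : ∀ i f, Set.BijOn (φ i) ((M i).face f).verts (S.face (ψ i f)).verts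
  face_adj : ∀ i f v w, ((M i).face f).Adj v w → (S.face (ψ i f)).Adj (φ i v) (φ i w)
  /-- The gluing map does not fold anything at a vertex. -/
  locally_injective : ∀ i v, Set.InjOn (φ i) ((M i).G.neighborSet v)
  /-- The boundary of the pieces is exactly what lies over `Γ`. -/
  boundary_edge : ∀ i v w, (M i).G.Adj v w →
    ((M i).boundary.Adj v w ↔ Γ.Adj (φ i v) (φ i w))
  boundary_vertex : ∀ i v, v ∈ (M i).boundary.support ↔ φ i v ∈ Γ.verts
  /-- Away from `Γ` nothing is glued. -/
  vertex_off : ∀ v, v ∉ Γ.verts → ∃! x : Σ i, (M i).V, φ x.1 x.2 = v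
  edge_off : ∀ v w, S.G.Adj v w → ¬ Γ.Adj v w →
    ∃! x : Σ i, (M i).V × (M i).V,
      (M x.1).G.Adj x.2.1 x.2.2 ∧ φ x.1 x.2.1 = v ∧ φ x.1 x.2.2 = w
  /-- Each edge of `Γ` comes from exactly two boundary edges. -/
  edge_on : ∀ v w, Γ.Adj v w →
    {x : Σ i, (M i).V × (M i).V |
      (M x.1).boundary.Adj x.2.1 x.2.2 ∧ φ x.1 x.2.1 = v ∧ φ x.1 x.2.2 = w}.ncard = 2
  /-- A vertex of `Γ` comes from as many boundary vertices as it has neighbours in `Γ`. -/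
  vertex_on : ∀ v ∈ Γ.verts,
    {x : Σ i, (M i).V | φ x.1 x.2 = v}.ncard = (Γ.neighborSet v).ncard

end DiscreteSurface

/-- With respect to the levels `A₁ < A₂ < ⋯ < Aₙ`, the values `x` and `y` are gradually varied:
if `x` is the level `A i`, then `y` is `A i` or one of the neighbouring levels. -/
def GraduallyVaried {n : ℕ} (A : Fin n → ℝ) (x y : ℝ) : Prop :=
  ∃ i j : Fin n, x = A i ∧ y = A j ∧ |(i : ℤ) - (j : ℤ)| ≤ 1

/-- A path in a graph is gradually varied for the assigned values `val` if the values at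
adjacent vertices of the path are. -/
def IsGraduallyVariedPath {V : Type u} {G : SimpleGraph V} {n : ℕ} (A : Fin n → ℝ) (val : V → ℝ)
    {a b : V} (p : G.Walk a b) : Prop :=
  ∀ v w, p.toSubgraph.Adj v w → GraduallyVaried A (val v) (val w)

/-! Direct the faces coherently. Turning around a vertex `v` (leave a face by its outgoing edge,
enter the face across it) moves the faces at `v` in a single cycle; this is the usable form of link
connectivity (`mem_of_turn_closed`). The edges of `Γ` at `v` split the cycle into sectors, each with
exactly one face whose outgoing edge is cut (`exists_out_cut`, `out_cut_unique`). So a vertex of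
degree `d ≥ 2` in `Γ` has `d` sectors, and the two faces at a cut edge lie in different ones
(`not_sameSector`).

The pieces are the classes of faces joined across uncut edges; a vertex of a piece is a vertex of
the surface with one of its sectors. The conditions in `piece_isCutAlong` reduce to these facts
about sectors.

In degree two, suppose that `a ≠ b` on one boundary curve lie over the same vertex. The two sides of
`Γ` are directed oppositely, so a step forward from `a` and a step backward from `b` again give
distinct points over one vertex (`base_eq_of_boundaryStep`). Repeating this, the two arrive in the
middle of the arc at a single vertex or at the two ends of one edge, and both are impossible. -/

namespace DiscreteSurface

/-- `o f v w` says that the edge `vw` of the face `f` is directed from `v` to `w`; the boundary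
cycles of the faces are directed so that faces with a common edge direct it oppositely. -/
structure IsOrientation (S : DiscreteSurface.{u}) (o : S.F → S.V → S.V → Prop) : Prop where
  adj_iff : ∀ f v w, (S.face f).Adj v w ↔ (o f v w ∨ o f w v)
  asymm : ∀ f v w, o f v w → ¬ o f w v
  existsUnique_out : ∀ f, ∀ v ∈ (S.face f).verts, ∃! w, o f v w
  opposite : ∀ f f' v w, f ≠ f' → o f v w → (S.face f').Adj v w → o f' w v

variable {S : DiscreteSurface.{u}} {o : S.F → S.V → S.V → Prop}

/-! ### Directed edges and turning around a vertex -/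

namespace IsOrientation

theorem adj (ho : S.IsOrientation o) {f : S.F} {v w : S.V} (h : o f v w) : (S.face f).Adj v w :=
  (ho.adj_iff f v w).2 (Or.inl h)

theorem adj' (ho : S.IsOrientation o) {f : S.F} {v w : S.V} (h : o f w v) : (S.face f).Adj v w :=
  (ho.adj_iff f v w).2 (Or.inr h)

theorem eq_of_out (ho : S.IsOrientation o) {f : S.F} {v a b : S.V} (ha : o f v a) (hb : o f v b) :
    a = b :=
  (ho.existsUnique_out f v (ho.adj ha).fst_mem).unique ha hb

/-- A face has two edges at `v`; exactly one leaves `v`, so the other one enters. -/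
theorem existsUnique_in (ho : S.IsOrientation o) (f : S.F) (v : S.V)
    (hv : v ∈ (S.face f).verts) : ∃! w, o f w v := by
  obtain ⟨a, b, hab, hs⟩ := Set.ncard_eq_two.1 (S.face_regular f v hv)
  have key : ∀ w, (S.face f).Adj v w ↔ w = a ∨ w = b := fun w => by
    rw [← SimpleGraph.Subgraph.mem_neighborSet, hs]; simp
  have hin : ∀ c w, o f v c → (S.face f).Adj v w → w ≠ c → o f w v := fun c w hc hw hne =>
    ((ho.adj_iff f v w).1 hw).resolve_left fun h => hne (ho.eq_of_out h hc)
  have haux : ∀ c d, (∀ w, (S.face f).Adj v w ↔ w = c ∨ w = d) → c ≠ d → o f v c →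
      ∃! w, o f w v := fun c d hcd hne hc => by
    refine ⟨d, hin c d hc ((hcd d).2 (Or.inr rfl)) hne.symm, fun w hw => ?_⟩
    refine ((hcd w).1 (ho.adj' hw)).resolve_left ?_
    rintro rfl
    exact ho.asymm _ _ _ hc hw
  obtain ⟨c, hc, -⟩ := ho.existsUnique_out f v hv
  rcases (key c).1 (ho.adj hc) with rfl | rfl
  · exact haux c b key hab hc
  · exact haux c a (fun w => (key w).trans or_comm) hab.symm hc

theorem eq_of_in (ho : S.IsOrientation o) {f : S.F} {v a b : S.V} (ha : o f a v) (hb : o f b v) :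
    a = b :=
  (ho.existsUnique_in f v (ho.adj ha).snd_mem).unique ha hb

theorem reverse (ho : S.IsOrientation o) : S.IsOrientation (fun f v w => o f w v) where
  adj_iff f v w := (ho.adj_iff f v w).trans or_comm
  asymm f v w := ho.asymm f w v
  existsUnique_out := ho.existsUnique_in
  opposite f f' v w hne h h' := ho.opposite f f' w v hne h h'.symm

theorem face_eq (ho : S.IsOrientation o) {f g : S.F} {v w : S.V} (hf : o f v w) (hg : o g v w) :
    f = g := by
  by_contra hne
  exact ho.asymm _ _ _ hg (ho.opposite f g v w hne hf (ho.adj hg))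

theorem exists_opposite (ho : S.IsOrientation o) (hc : S.IsClosed) {f : S.F} {v w : S.V}
    (h : o f v w) : ∃ g, o g w v := by
  have h2 := hc v w (ho.adj h).adj_sub
  obtain ⟨g, hg, hne⟩ := Set.exists_ne_of_one_lt_ncard (one_lt_two.trans_eq h2.symm) f
  exact ⟨g, ho.opposite f g v w hne.symm h hg⟩

theorem exists_face (ho : S.IsOrientation o) (hc : S.IsClosed) {v w : S.V}
    (h : S.G.Adj v w) : ∃ f, o f v w := by
  have h2 := hc v w h
  obtain ⟨f, hf⟩ := Set.nonempty_of_ncard_ne_zero (h2.trans_ne two_ne_zero)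
  rcases (ho.adj_iff f v w).1 hf with hf | hf
  · exact ⟨f, hf⟩
  · exact ho.exists_opposite hc hf

/-- A set of faces at `v` that is closed under turning around `v` contains all faces at `v`. -/
theorem mem_of_turn_closed (ho : S.IsOrientation o) (hc : S.IsClosed) {v : S.V} {X : Set S.F}
    (hv : ∀ f ∈ X, v ∈ (S.face f).verts) (hne : X.Nonempty)
    (hX : ∀ f ∈ X, ∀ w, o f v w → ∀ g, o g w v → g ∈ X) {f : S.F}
    (hf : v ∈ (S.face f).verts) : f ∈ X := by
  have := S.finite_F
  have hsucc : ∀ f : X, ∃ g : X, ∃ w, o f v w ∧ o g w v := fun f => by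
    obtain ⟨w, hw, -⟩ := ho.existsUnique_out f v (hv f f.2)
    obtain ⟨g, hg⟩ := ho.exists_opposite hc hw
    exact ⟨⟨g, hX f f.2 w hw g hg⟩, w, hw, hg⟩
  choose s hs using hsucc
  have hinj : Function.Injective s := fun a b hab => by
    obtain ⟨w, hw, hg⟩ := hs a
    obtain ⟨w', hw', hg'⟩ := hs b
    rw [hab] at hg
    obtain rfl := ho.eq_of_in hg hg'
    exact Subtype.ext (ho.face_eq hw hw')
  have hsurj := Finite.surjective_of_injective hinj
  -- Turning is injective on the finite set `X`, hence onto, so `X` is also closed under turning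
  -- backwards.
  have hX' : ∀ g ∈ X, ∀ w, o g w v → ∀ f, o f v w → f ∈ X := fun g hg w hw f hf => by
    obtain ⟨f', hf'⟩ := hsurj ⟨g, hg⟩
    obtain ⟨w', h1, h2⟩ := hs f'
    rw [hf'] at h2
    obtain rfl := ho.eq_of_in hw h2
    rw [ho.face_eq hf h1]
    exact f'.2
  have hshare : ∀ f ∈ X, ∀ g w, (S.face f).Adj v w → (S.face g).Adj v w → g ∈ X := by
    intro f hf g w hfw hgw
    rcases (ho.adj_iff f v w).1 hfw with h1 | h1 <;> rcases (ho.adj_iff g v w).1 hgw with h2 | h2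
    · rwa [← ho.face_eq h1 h2]
    · exact hX f hf w h1 g h2
    · exact hX' f hf w h1 g h2
    · rwa [← ho.face_eq h1 h2]
  obtain ⟨f₀, hf₀⟩ := hne
  obtain ⟨a, ha, -⟩ := ho.existsUnique_out f₀ v (hv f₀ hf₀)
  obtain ⟨b, hb, -⟩ := ho.existsUnique_out f v hf
  have hall : ∀ b, Relation.ReflTransGen
      (fun x y => ∃ f, (S.face f).Adj v x ∧ (S.face f).Adj v y) a b →
      ∀ g, (S.face g).Adj v b → g ∈ X := fun b hlink => by
    induction hlink with
    | refl => exact fun g hg => hshare f₀ hf₀ g a (ho.adj ha) hg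
    | tail _ hstep ih =>
      obtain ⟨h, h1, h2⟩ := hstep
      exact fun g hg => hshare h (ih h h1) g _ h2 hg
  exact hall b (S.link_connected v a b (ho.adj ha).adj_sub (ho.adj hb).adj_sub) f (ho.adj hb)

end IsOrientation

/-! ### Sectors at a vertex -/

/-- The faces `f` and `g` have an edge at `v` in common that is not cut. -/
def CutStep (Γ : S.G.Subgraph) (v : S.V) (f g : S.F) : Prop :=
  ∃ w, ¬ Γ.Adj v w ∧ (S.face f).Adj v w ∧ (S.face g).Adj v w

/-- The faces `f` and `g` lie in the same sector at `v` between edges of `Γ`. -/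
def SameSector (Γ : S.G.Subgraph) (v : S.V) : S.F → S.F → Prop :=
  Relation.ReflTransGen (CutStep Γ v)

variable {Γ : S.G.Subgraph}

theorem CutStep.symm {v : S.V} {f g : S.F} : CutStep Γ v f g → CutStep Γ v g f :=
  fun ⟨w, h, h1, h2⟩ => ⟨w, h, h2, h1⟩

theorem SameSector.symm {v : S.V} {f g : S.F} (h : SameSector Γ v f g) : SameSector Γ v g f :=
  (@Relation.ReflTransGen.stdSymm _ _ ⟨fun _ _ => CutStep.symm⟩).symm _ _ h

theorem SameSector.mem_verts {v : S.V} {f g : S.F} (h : SameSector Γ v f g)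
    (hf : v ∈ (S.face f).verts) : v ∈ (S.face g).verts := by
  induction h with
  | refl => exact hf
  | tail _ h _ => obtain ⟨w, -, -, h⟩ := h; exact h.fst_mem

namespace IsOrientation

/-- Otherwise the sector would be closed under turning and contain all faces at `v`, among them the
one that leaves `v` along the cut edge `vw`. -/
theorem exists_out_cut (ho : S.IsOrientation o) (hc : S.IsClosed) {v w : S.V} (hw : Γ.Adj v w)
    {f : S.F} (hf : v ∈ (S.face f).verts) :
    ∃ g a, SameSector Γ v f g ∧ o g v a ∧ Γ.Adj v a := by
  by_contra! hno
  obtain ⟨g, hg⟩ := ho.exists_face hc hw.adj_sub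
  have : g ∈ {g | SameSector Γ v f g} := by
    refine ho.mem_of_turn_closed hc (fun g hg => SameSector.mem_verts hg hf)
      ⟨f, Relation.ReflTransGen.refl⟩ (fun g hg a ha h hh => ?_) (ho.adj hg).fst_mem
    exact Relation.ReflTransGen.tail hg ⟨a, hno g a hg ha, ho.adj ha, ho.adj' hh⟩
  exact hno g w this hg hw

/-- Turning across uncut edges (`N`) is deterministic and stops at `f`, so every face of the sector
turns into `f`; but `g` is a stop as well. -/
theorem out_cut_unique (ho : S.IsOrientation o) {v a b : S.V} {f g : S.F}
    (hfg : SameSector Γ v f g) (hf : o f v a) (ha : Γ.Adj v a) (hg : o g v b)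
    (hb : Γ.Adj v b) : f = g := by
  let N : S.F → S.F → Prop := fun f g => ∃ w, ¬ Γ.Adj v w ∧ o f v w ∧ o g w v
  have hN : Relation.ReflTransGen N g f := by
    clear hg
    induction hfg with
    | refl => exact Relation.ReflTransGen.refl
    | @tail g h _ hstep ih =>
      obtain ⟨w, hw, h1, h2⟩ := hstep
      rcases (ho.adj_iff g v w).1 h1 with h1 | h1 <;> rcases (ho.adj_iff h v w).1 h2 with h2 | h2
      · rwa [← ho.face_eq h1 h2]
      · rcases ih.cases_head with rfl | ⟨k, ⟨w', hw', h3, h4⟩, hk⟩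
        · exact absurd (ho.eq_of_out hf h1 ▸ ha) hw
        · obtain rfl := ho.eq_of_out h1 h3
          rwa [ho.face_eq h2 h4]
      · exact ih.head ⟨w, hw, h2, h1⟩
      · rwa [← ho.face_eq h1 h2]
  rcases hN.cases_head with h | ⟨k, ⟨w, hw, h1, -⟩, -⟩
  · exact h.symm
  · exact absurd (ho.eq_of_out hg h1 ▸ hb) hw

/-- The two faces at an edge of `Γ` lie in different sectors. -/
theorem not_sameSector (ho : S.IsOrientation o) (hc : S.IsClosed)
    (hΓ : ∀ v ∈ Γ.verts, 2 ≤ (Γ.neighborSet v).ncard) {v w : S.V} (hw : Γ.Adj v w) {f g : S.F}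
    (hf : o f v w) (hg : o g w v) : ¬ SameSector Γ v f g := fun hfg => by
  obtain ⟨b, hb, hne⟩ := Set.exists_ne_of_one_lt_ncard (hΓ v hw.fst_mem) w
  obtain ⟨k, hk⟩ := ho.exists_face hc (Γ.adj_sub hb)
  -- If `f` and `g` shared a sector, its only cut exit would lead from `f` back into it through `g`.
  -- The sector would then be closed under turning and have a second cut exit, along the other
  -- neighbour `b`.
  have : k ∈ {g | SameSector Γ v f g} := by
    refine ho.mem_of_turn_closed hc (fun g hg => SameSector.mem_verts hg (ho.adj hf).fst_mem)
      ⟨f, Relation.ReflTransGen.refl⟩ (fun h hh a ha l hl => ?_) (ho.adj hk).fst_mem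
    by_cases hcut : Γ.Adj v a
    · obtain rfl := ho.out_cut_unique hh hf hw ha hcut
      obtain rfl := ho.eq_of_out hf ha
      rwa [ho.face_eq hl hg]
    · exact Relation.ReflTransGen.tail hh ⟨a, hcut, ho.adj ha, ho.adj' hl⟩
  obtain rfl := ho.out_cut_unique this hf hw hk hb
  exact hne (ho.eq_of_out hk hf)

theorem face_eq_of_sameSector (ho : S.IsOrientation o) (hc : S.IsClosed)
    (hΓ : ∀ v ∈ Γ.verts, 2 ≤ (Γ.neighborSet v).ncard) {v w : S.V} (hw : Γ.Adj v w) {f g : S.F}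
    (hf : (S.face f).Adj v w) (hg : (S.face g).Adj v w) (h : SameSector Γ v f g) : f = g := by
  rcases (ho.adj_iff f v w).1 hf with h1 | h1 <;> rcases (ho.adj_iff g v w).1 hg with h2 | h2
  · exact ho.face_eq h1 h2
  · exact absurd h (ho.not_sameSector hc hΓ hw h1 h2)
  · exact absurd h.symm (ho.not_sameSector hc hΓ hw h2 h1)
  · exact ho.face_eq h1 h2

/-- Away from `Γ` there is only one sector. -/
theorem sameSector_of_not_mem (ho : S.IsOrientation o) (hc : S.IsClosed) {v : S.V}
    (hv : v ∉ Γ.verts) {f g : S.F} (hf : v ∈ (S.face f).verts) (hg : v ∈ (S.face g).verts) :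
    SameSector Γ v f g := by
  refine ho.mem_of_turn_closed (X := {g | SameSector Γ v f g}) hc
    (fun g hg => SameSector.mem_verts hg hf) ⟨f, Relation.ReflTransGen.refl⟩
    (fun h hh a ha l hl => ?_) hg
  exact Relation.ReflTransGen.tail hh ⟨a, fun h => hv h.fst_mem, ho.adj ha, ho.adj' hl⟩

end IsOrientation

/-! ### Pieces and their vertices -/

variable (Γ) in
/-- The pieces into which `Γ` cuts the surface: classes of faces joined through uncut edges. -/
def PieceIndex : Type u :=
  Quot fun f g : S.F => ∃ v, CutStep Γ v f g

variable (Γ) in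
/-- The piece that contains a face. -/
def pieceOf (f : S.F) : PieceIndex Γ :=
  Quot.mk _ f

theorem SameSector.pieceOf_eq {v : S.V} {f g : S.F} (h : SameSector Γ v f g) :
    pieceOf Γ f = pieceOf Γ g := by
  induction h with
  | refl => rfl
  | tail _ h ih => exact ih.trans (Quot.sound ⟨v, h⟩)

variable (Γ) in
/-- The vertices of a piece: vertices of the surface together with a sector in that piece. -/
def PieceVertex (i : PieceIndex Γ) : Type u :=
  {x : S.V × Set S.F // ∃ f, pieceOf Γ f = i ∧ x.1 ∈ (S.face f).verts ∧
    x.2 = {g | SameSector Γ x.1 f g}}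

namespace PieceVertex

variable {i j : PieceIndex Γ}

/-- The vertex of the surface to which a vertex of a piece is glued. -/
def base (x : PieceVertex Γ i) : S.V := x.1.1

/-- The faces around a vertex of a piece. -/
def sector (x : PieceVertex Γ i) : Set S.F := x.1.2

theorem exists_sector_eq (x : PieceVertex Γ i) : ∃ f, pieceOf Γ f = i ∧
    x.base ∈ (S.face f).verts ∧ x.sector = {g | SameSector Γ x.base f g} :=
  x.2

theorem pieceOf_eq (x : PieceVertex Γ i) {f : S.F} (hf : f ∈ x.sector) : pieceOf Γ f = i := by
  obtain ⟨g, hi, -, hs⟩ := x.exists_sector_eq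
  rw [hs] at hf
  exact (SameSector.pieceOf_eq hf).symm.trans hi

theorem base_mem (x : PieceVertex Γ i) {f : S.F} (hf : f ∈ x.sector) :
    x.base ∈ (S.face f).verts := by
  obtain ⟨g, -, hv, hs⟩ := x.exists_sector_eq
  rw [hs] at hf
  exact SameSector.mem_verts hf hv

theorem mem_sector_iff (x : PieceVertex Γ i) {f g : S.F} (hf : f ∈ x.sector) :
    g ∈ x.sector ↔ SameSector Γ x.base f g := by
  obtain ⟨h, -, -, hs⟩ := x.exists_sector_eq
  rw [hs] at hf ⊢
  exact ⟨fun hg => hf.symm.trans hg, fun hg => hf.trans hg⟩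

theorem exists_mem (x : PieceVertex Γ i) : ∃ f, f ∈ x.sector := by
  obtain ⟨h, -, -, hs⟩ := x.exists_sector_eq
  exact ⟨h, hs ▸ Relation.ReflTransGen.refl⟩

/-- Sectors are equivalence classes, so one common face suffices. -/
theorem eq_of_mem {x y : PieceVertex Γ i} (h : x.base = y.base) {f : S.F} (hx : f ∈ x.sector)
    (hy : f ∈ y.sector) : x = y := by
  refine Subtype.ext (Prod.ext h (Set.ext fun g => ?_))
  have h1 := x.mem_sector_iff (g := g) hx
  rw [h, ← y.mem_sector_iff hy] at h1
  exact h1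

theorem sigma_eq_of_mem {x : Σ i, PieceVertex Γ i} {y : Σ i, PieceVertex Γ i}
    (h : x.2.base = y.2.base) {f : S.F} (hx : f ∈ x.2.sector) (hy : f ∈ y.2.sector) : x = y := by
  obtain ⟨i, x⟩ := x
  obtain ⟨j, y⟩ := y
  obtain rfl : i = j := (x.pieceOf_eq hx).symm.trans (y.pieceOf_eq hy)
  exact congrArg (Sigma.mk i) (eq_of_mem h hx hy)

theorem exists_of_mem_verts {f : S.F} (hf : pieceOf Γ f = i) {v : S.V}
    (hv : v ∈ (S.face f).verts) : ∃ x : PieceVertex Γ i, x.base = v ∧ f ∈ x.sector :=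
  ⟨⟨(v, {g | SameSector Γ v f g}), f, hf, hv, rfl⟩, rfl, Relation.ReflTransGen.refl⟩

/-- The corner of a face at one of its vertices. -/
noncomputable def corner (f : {f : S.F // pieceOf Γ f = i}) (v : (S.face f.1).verts) :
    PieceVertex Γ i :=
  (exists_of_mem_verts f.2 v.2).choose

theorem base_corner (f : {f : S.F // pieceOf Γ f = i}) (v : (S.face f.1).verts) :
    (corner f v).base = v :=
  (exists_of_mem_verts f.2 v.2).choose_spec.1

theorem mem_sector_corner (f : {f : S.F // pieceOf Γ f = i}) (v : (S.face f.1).verts) :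
    f.1 ∈ (corner f v).sector :=
  (exists_of_mem_verts f.2 v.2).choose_spec.2

theorem mem_of_adj_of_not_cut {x : PieceVertex Γ i} {f g : S.F} {w : S.V}
    (hw : ¬ Γ.Adj x.base w) (hf : (S.face f).Adj x.base w) (hg : (S.face g).Adj x.base w)
    (hx : f ∈ x.sector) : g ∈ x.sector :=
  (x.mem_sector_iff hx).2 (Relation.ReflTransGen.single ⟨w, hw, hf, hg⟩)

end PieceVertex

/-! ### Each piece is a discrete surface -/

variable (Γ) in
/-- The one-skeleton of a piece. -/
def pieceGraph (i : PieceIndex Γ) : SimpleGraph (PieceVertex Γ i) where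
  Adj x y := ∃ f, (S.face f).Adj x.base y.base ∧ f ∈ x.sector ∧ f ∈ y.sector
  symm := ⟨fun _ _ ⟨f, h, hx, hy⟩ => ⟨f, h.symm, hy, hx⟩⟩
  loopless := ⟨fun _ ⟨_, h, _, _⟩ => h.adj_sub.ne rfl⟩

/-- The boundary cycle of a face of a piece. -/
def pieceFace {i : PieceIndex Γ} (f : {f : S.F // pieceOf Γ f = i}) :
    (pieceGraph Γ i).Subgraph where
  verts := {x | f.1 ∈ x.sector}
  Adj x y := (S.face f.1).Adj x.base y.base ∧ f.1 ∈ x.sector ∧ f.1 ∈ y.sector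
  adj_sub h := ⟨f.1, h⟩
  edge_vert h := h.2.1
  symm := ⟨fun _ _ ⟨h, hx, hy⟩ => ⟨h.symm, hy, hx⟩⟩

section

variable {i : PieceIndex Γ}

theorem bijOn_base_pieceFace (f : {f : S.F // pieceOf Γ f = i}) :
    Set.BijOn PieceVertex.base (pieceFace f).verts (S.face f.1).verts := by
  refine ⟨fun x hx => x.base_mem hx, fun x hx y hy h => PieceVertex.eq_of_mem h hx hy,
    fun v hv => ?_⟩
  obtain ⟨x, hx, hf⟩ := PieceVertex.exists_of_mem_verts f.2 hv
  exact ⟨x, hf, hx⟩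

theorem pieceFace_connected (f : {f : S.F // pieceOf Γ f = i}) : (pieceFace f).Connected := by
  refine ⟨(S.face_connected f.1).coe.map
    (⟨fun v => ⟨PieceVertex.corner f v, PieceVertex.mem_sector_corner f v⟩, ?_⟩ :
      (S.face f.1).coe →g (pieceFace f).coe) ?_⟩
  · intro v w h
    refine ⟨?_, PieceVertex.mem_sector_corner f v, PieceVertex.mem_sector_corner f w⟩
    rw [PieceVertex.base_corner, PieceVertex.base_corner]
    exact h
  · intro x
    refine ⟨⟨x.1.base, x.1.base_mem x.2⟩, Subtype.ext ?_⟩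
    exact PieceVertex.eq_of_mem (PieceVertex.base_corner f _) (PieceVertex.mem_sector_corner f _)
      x.2

theorem pieceFace_regular (f : {f : S.F // pieceOf Γ f = i}) (x : PieceVertex Γ i)
    (hx : x ∈ (pieceFace f).verts) : ((pieceFace f).neighborSet x).ncard = 2 := by
  rw [← S.face_regular f.1 x.base (x.base_mem hx)]
  refine Set.BijOn.ncard_eq (f := PieceVertex.base) ⟨fun y hy => hy.1,
    fun y hy z hz h => PieceVertex.eq_of_mem h hy.2.2 hz.2.2, fun w hw => ?_⟩
  obtain ⟨y, rfl, hy⟩ := PieceVertex.exists_of_mem_verts f.2 (S.face f.1 |>.edge_vert hw.symm)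
  exact ⟨y, ⟨hw, hx, hy⟩, rfl⟩

theorem pieceGraph_reachable_of_mem {f : S.F} {x y : PieceVertex Γ i} (hx : f ∈ x.sector)
    (hy : f ∈ y.sector) : (pieceGraph Γ i).Reachable x y := by
  have := (pieceFace_connected (⟨f, x.pieceOf_eq hx⟩ : {f : S.F // pieceOf Γ f = i})) ⟨x, hx⟩
    ⟨y, hy⟩
  exact this.map (pieceFace _).hom

/-- Face boundaries are connected, and faces adjacent across an uncut edge share a vertex of the
piece. -/
theorem pieceGraph_connected (i : PieceIndex Γ) : (pieceGraph Γ i).Connected := by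
  have key : ∀ f g : S.F, Relation.EqvGen (fun f g : S.F => ∃ v, CutStep Γ v f g) f g →
      pieceOf Γ f = i → ∀ x y : PieceVertex Γ i, f ∈ x.sector → g ∈ y.sector →
      (pieceGraph Γ i).Reachable x y := by
    intro f g h
    induction h with
    | rel f g h =>
      obtain ⟨v, w, hw, hf, hg⟩ := h
      intro hi x y hx hy
      obtain ⟨z, rfl, hz⟩ := PieceVertex.exists_of_mem_verts hi hf.fst_mem
      exact (pieceGraph_reachable_of_mem hx hz).trans (pieceGraph_reachable_of_mem
        (PieceVertex.mem_of_adj_of_not_cut hw hf hg hz) hy)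
    | refl f => exact fun _ x y hx hy => pieceGraph_reachable_of_mem hx hy
    | symm f g _ ih =>
      exact fun _ x y hx hy => (ih (y.pieceOf_eq hy) y x hy hx).symm
    | trans f g h hfg _ ih1 ih2 =>
      intro hi x y hx hy
      have hg : pieceOf Γ g = i := (Quot.eqvGen_sound hfg).symm.trans hi
      obtain ⟨v, hv⟩ := (S.face_connected g).coe.nonempty
      obtain ⟨z, -, hz⟩ := PieceVertex.exists_of_mem_verts hg hv
      exact (ih1 hi x z hx hz).trans (ih2 hg z y hz hy)
  obtain ⟨f, rfl⟩ : ∃ f, pieceOf Γ f = i := Quot.exists_rep i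
  obtain ⟨v, hv⟩ := (S.face_connected f).coe.nonempty
  obtain ⟨z, -, hz⟩ := PieceVertex.exists_of_mem_verts (rfl : pieceOf Γ f = _) hv
  have : Nonempty (PieceVertex Γ (pieceOf Γ f)) := ⟨z⟩
  refine ⟨fun x y => ?_⟩
  obtain ⟨g, hg⟩ := x.exists_mem
  obtain ⟨h, hh⟩ := y.exists_mem
  exact key g h (Quot.eqvGen_exact ((x.pieceOf_eq hg).trans (y.pieceOf_eq hh).symm))
    (x.pieceOf_eq hg) x y hg hh

/-- A sector is a chain of faces through uncut edges at `x.base`; each such edge lifts to a node of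
the link joining consecutive faces. -/
theorem pieceGraph_link_connected (x a b : PieceVertex Γ i) (ha : (pieceGraph Γ i).Adj x a)
    (hb : (pieceGraph Γ i).Adj x b) :
    Relation.ReflTransGen (fun y z => ∃ f : {f : S.F // pieceOf Γ f = i},
      (pieceFace f).Adj x y ∧ (pieceFace f).Adj x z) a b := by
  obtain ⟨f, hf, hfx, hfa⟩ := ha
  obtain ⟨g, hg, hgx, hgb⟩ := hb
  have hfg := (x.mem_sector_iff hfx).1 hgx
  clear hgx
  induction hfg generalizing b with
  | refl => exact .single ⟨⟨f, x.pieceOf_eq hfx⟩, ⟨hf, hfx, hfa⟩, hg, hfx, hgb⟩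
  | @tail g k hfg hstep ih =>
    have hgx : g ∈ x.sector := (x.mem_sector_iff hfx).2 hfg
    obtain ⟨w, hw, h1, h2⟩ := hstep
    obtain ⟨c, rfl, hc⟩ := PieceVertex.exists_of_mem_verts (x.pieceOf_eq hgx) h1.snd_mem
    have hkx := PieceVertex.mem_of_adj_of_not_cut hw h1 h2 hgx
    have hkc := PieceVertex.mem_of_adj_of_not_cut (fun h => hw h.symm) h1.symm h2.symm hc
    exact (ih c h1 hc).tail ⟨⟨k, x.pieceOf_eq hkx⟩, ⟨h2, hkx, hkc⟩, hg, hkx, hgb⟩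

theorem IsOrientation.face_eq_of_mem_sector (ho : S.IsOrientation o) (hc : S.IsClosed)
    (hΓ : ∀ v ∈ Γ.verts, 2 ≤ (Γ.neighborSet v).ncard) {x : PieceVertex Γ i} {w : S.V}
    (hw : Γ.Adj x.base w) {f g : S.F} (hf : (S.face f).Adj x.base w)
    (hg : (S.face g).Adj x.base w) (hfx : f ∈ x.sector) (hgx : g ∈ x.sector) : f = g :=
  ho.face_eq_of_sameSector hc hΓ hw hf hg ((x.mem_sector_iff hfx).1 hgx)

theorem ncard_pieceFace_cut (ho : S.IsOrientation o) (hc : S.IsClosed)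
    (hΓ : ∀ v ∈ Γ.verts, 2 ≤ (Γ.neighborSet v).ncard) {x y : PieceVertex Γ i}
    (h : (pieceGraph Γ i).Adj x y) (hcut : Γ.Adj x.base y.base) :
    {f : {f : S.F // pieceOf Γ f = i} | (pieceFace f).Adj x y}.ncard = 1 := by
  obtain ⟨f, hf, hx, hy⟩ := h
  refine Set.ncard_eq_one.2 ⟨⟨f, x.pieceOf_eq hx⟩, Set.ext fun g => ⟨fun hg => ?_, ?_⟩⟩
  · exact Subtype.ext (ho.face_eq_of_mem_sector hc hΓ hcut hg.1 hf hg.2.1 hx)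
  · rintro rfl
    exact ⟨hf, hx, hy⟩

theorem ncard_pieceFace_not_cut (hc : S.IsClosed) {x y : PieceVertex Γ i}
    (h : (pieceGraph Γ i).Adj x y) (hcut : ¬ Γ.Adj x.base y.base) :
    {f : {f : S.F // pieceOf Γ f = i} | (pieceFace f).Adj x y}.ncard = 2 := by
  obtain ⟨f, hf, hx, hy⟩ := h
  rw [← hc x.base y.base hf.adj_sub]
  refine Set.BijOn.ncard_eq (f := Subtype.val) ⟨fun g hg => hg.1,
    Subtype.val_injective.injOn, fun g hg => ?_⟩
  have hgx := PieceVertex.mem_of_adj_of_not_cut hcut hf hg hx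
  have hgy := PieceVertex.mem_of_adj_of_not_cut (fun h => hcut h.symm) hf.symm hg.symm hy
  exact ⟨⟨g, x.pieceOf_eq hgx⟩, ⟨hg, hgx, hgy⟩, rfl⟩

end

variable (Γ) in
/-- One of the surfaces with boundary into which a closed oriented surface is cut along `Γ`. -/
def piece (ho : S.IsOrientation o) (hc : S.IsClosed)
    (hΓ : ∀ v ∈ Γ.verts, 2 ≤ (Γ.neighborSet v).ncard) (i : PieceIndex Γ) :
    DiscreteSurface.{u} where
  V := PieceVertex Γ i
  F := {f : S.F // pieceOf Γ f = i}
  finite_V := by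
    have := S.finite_V
    have := S.finite_F
    exact inferInstanceAs (Finite (Subtype _))
  finite_F := by
    have := S.finite_F
    infer_instance
  nonempty_F := by
    obtain ⟨f, hf⟩ : ∃ f, pieceOf Γ f = i := Quot.exists_rep i
    exact ⟨⟨f, hf⟩⟩
  G := pieceGraph Γ i
  connected := pieceGraph_connected i
  face := pieceFace
  face_connected := pieceFace_connected
  face_regular := pieceFace_regular
  edge_faces x y h := by
    by_cases hcut : Γ.Adj x.base y.base
    · exact Or.inl (ncard_pieceFace_cut ho hc hΓ h hcut)
    · exact Or.inr (ncard_pieceFace_not_cut hc h hcut)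
  link_connected := pieceGraph_link_connected

/-! ### Boundary of the pieces and the gluing map -/

section

variable (ho : S.IsOrientation o) (hc : S.IsClosed)
  (hΓ : ∀ v ∈ Γ.verts, 2 ≤ (Γ.neighborSet v).ncard)

theorem piece_boundary_adj_iff {i : PieceIndex Γ} {x y : PieceVertex Γ i} :
    (piece Γ ho hc hΓ i).boundary.Adj x y ↔
      (pieceGraph Γ i).Adj x y ∧ Γ.Adj x.base y.base := by
  refine ⟨fun h => ⟨h.1, ?_⟩, fun h => ⟨h.1, ncard_pieceFace_cut ho hc hΓ h.1 h.2⟩⟩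
  by_contra hcut
  have h1 := h.2.symm.trans (ncard_pieceFace_not_cut hc h.1 hcut)
  omega

theorem exists_adj_of_mem_verts (hΓ : ∀ v ∈ Γ.verts, 2 ≤ (Γ.neighborSet v).ncard) {v : S.V}
    (hv : v ∈ Γ.verts) : ∃ w, Γ.Adj v w :=
  Set.nonempty_of_ncard_ne_zero (s := Γ.neighborSet v) (by have := hΓ v hv; omega)

/-- Around a boundary vertex there is a face whose outgoing edge is cut. -/
theorem PieceVertex.exists_out_cut (ho : S.IsOrientation o) (hc : S.IsClosed)
    (hΓ : ∀ v ∈ Γ.verts, 2 ≤ (Γ.neighborSet v).ncard) {i : PieceIndex Γ} (x : PieceVertex Γ i)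
    (hx : x.base ∈ Γ.verts) : ∃ f ∈ x.sector, ∃ w, o f x.base w ∧ Γ.Adj x.base w := by
  obtain ⟨f, hf⟩ := x.exists_mem
  obtain ⟨w, hw⟩ := exists_adj_of_mem_verts hΓ hx
  obtain ⟨g, a, hg, ha, hcut⟩ := ho.exists_out_cut hc hw (x.base_mem hf)
  exact ⟨g, (x.mem_sector_iff hf).2 hg, a, ha, hcut⟩

theorem piece_mem_support_iff {i : PieceIndex Γ} {x : PieceVertex Γ i} :
    x ∈ (piece Γ ho hc hΓ i).boundary.support ↔ x.base ∈ Γ.verts := by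
  constructor
  · rintro ⟨y, h⟩
    exact ((piece_boundary_adj_iff ho hc hΓ).1 h).2.fst_mem
  · intro hx
    obtain ⟨f, hf, w, hw, hcut⟩ := x.exists_out_cut ho hc hΓ hx
    obtain ⟨y, rfl, hy⟩ := PieceVertex.exists_of_mem_verts (x.pieceOf_eq hf) (ho.adj hw).snd_mem
    exact ⟨y, (piece_boundary_adj_iff ho hc hΓ).2 ⟨⟨f, ho.adj hw, hf, hy⟩, hcut⟩⟩

theorem exists_sigma_of_mem_verts {f : S.F} {v : S.V} (hv : v ∈ (S.face f).verts) :
    ∃ x : Σ i, PieceVertex Γ i, x.2.base = v ∧ f ∈ x.2.sector := by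
  obtain ⟨x, h⟩ := PieceVertex.exists_of_mem_verts (rfl : pieceOf Γ f = _) hv
  exact ⟨⟨_, x⟩, h⟩

end

theorem exists_face_of_vertex (ho : S.IsOrientation o) (hc : S.IsClosed) (v : S.V) :
    ∃ f, v ∈ (S.face f).verts := by
  obtain ⟨f⟩ := S.nonempty_F
  obtain ⟨a, ha⟩ := (S.face_connected f).coe.nonempty
  obtain ⟨b, hb, -⟩ := ho.existsUnique_out f a ha
  have : Nontrivial S.V := ⟨a, b, (ho.adj hb).adj_sub.ne⟩
  obtain ⟨w, hw⟩ := S.connected.preconnected.exists_adj_of_nontrivial v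
  obtain ⟨g, hg⟩ := ho.exists_face hc hw
  exact ⟨g, (ho.adj hg).fst_mem⟩

theorem ncard_eq_of_rel {α β : Type*} {s : Set α} {t : Set β} (r : α → β → Prop)
    (hs : ∀ a ∈ s, ∃ b ∈ t, r a b) (ht : ∀ b ∈ t, ∃ a ∈ s, r a b)
    (hr : ∀ a ∈ s, ∀ b ∈ t, ∀ b' ∈ t, r a b → r a b' → b = b')
    (hl : ∀ b ∈ t, ∀ a ∈ s, ∀ a' ∈ s, r a b → r a' b → a = a') : s.ncard = t.ncard := by
  choose f hf hrf using hs
  refine Set.ncard_congr f hf (fun a a' ha ha' h => ?_) (fun b hb => ?_)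
  · exact hl _ (hf a ha) a ha a' ha' (hrf a ha) (h ▸ hrf a' ha')
  · obtain ⟨a, ha, hab⟩ := ht b hb
    exact ⟨a, ha, hr a ha _ (hf a ha) b hb (hrf a ha) hab⟩

theorem piece_isCutAlong (ho : S.IsOrientation o) (hc : S.IsClosed)
    (hΓ : ∀ v ∈ Γ.verts, 2 ≤ (Γ.neighborSet v).ncard) :
    S.IsCutAlong Γ (piece Γ ho hc hΓ) (fun _ => PieceVertex.base) (fun _ => Subtype.val) where
  face_bijective := by
    refine ⟨?_, fun f => ⟨⟨_, ⟨f, rfl⟩⟩, rfl⟩⟩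
    rintro ⟨i, f, rfl⟩ ⟨j, g, rfl⟩ rfl
    rfl
  face_verts _ f := bijOn_base_pieceFace f
  face_adj _ _ _ _ h := h.1
  locally_injective i x := by
    rintro y ⟨f, hf, hfx, hfy⟩ z ⟨g, hg, hgx, hgz⟩ h
    change PieceVertex.base y = PieceVertex.base z at h
    refine PieceVertex.eq_of_mem (f := g) h ?_ hgz
    rw [← h] at hg
    -- Over a cut edge the sector of `x` has only one face; across an uncut edge the sector at the
    -- far end continues.
    by_cases hcut : Γ.Adj (PieceVertex.base x) (PieceVertex.base y)
    · rwa [← ho.face_eq_of_mem_sector hc hΓ hcut hf hg hfx hgx]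
    · exact PieceVertex.mem_of_adj_of_not_cut (fun h => hcut h.symm) hf.symm hg.symm hfy
  boundary_edge _ _ _ h := (piece_boundary_adj_iff ho hc hΓ).trans (and_iff_right h)
  boundary_vertex _ _ := piece_mem_support_iff ho hc hΓ
  vertex_off v hv := by
    obtain ⟨f, hf⟩ := exists_face_of_vertex ho hc v
    obtain ⟨x, rfl, hx⟩ := exists_sigma_of_mem_verts (Γ := Γ) hf
    refine ⟨x, rfl, fun y (hy : y.2.base = x.2.base) => ?_⟩
    obtain ⟨g, hg⟩ := y.2.exists_mem
    refine PieceVertex.sigma_eq_of_mem hy hg ((x.2.mem_sector_iff hx).2 ?_)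
    exact ho.sameSector_of_not_mem hc hv hf (hy ▸ y.2.base_mem hg)
  edge_off v w h hcut := by
    obtain ⟨f, hf⟩ := ho.exists_face hc h
    have hf := ho.adj hf
    obtain ⟨x, rfl, hx⟩ := PieceVertex.exists_of_mem_verts (rfl : pieceOf Γ f = _) hf.fst_mem
    obtain ⟨y, rfl, hy⟩ := PieceVertex.exists_of_mem_verts (rfl : pieceOf Γ f = _) hf.snd_mem
    refine ⟨⟨_, x, y⟩, ⟨⟨f, hf, hx, hy⟩, rfl, rfl⟩, ?_⟩
    rintro ⟨j, x', y'⟩ ⟨⟨g, hg, hgx, hgy⟩, h1, h2⟩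
    change PieceVertex.base x' = _ at h1
    change PieceVertex.base y' = _ at h2
    rw [h1, h2] at hg
    have hgx' := PieceVertex.mem_of_adj_of_not_cut hcut hf hg hx
    have hgy' := PieceVertex.mem_of_adj_of_not_cut (fun h => hcut h.symm) hf.symm hg.symm hy
    obtain rfl := (PieceVertex.pieceOf_eq x' hgx).symm.trans (x.pieceOf_eq hgx')
    rw [PieceVertex.eq_of_mem h1 hgx hgx', PieceVertex.eq_of_mem h2 hgy hgy']
  edge_on v w hcut := by
    rw [← hc v w hcut.adj_sub]
    -- The lifts of `vw` are matched with the two faces of `S` at `vw`.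
    refine ncard_eq_of_rel (fun x f => f ∈ PieceVertex.sector x.2.1 ∧ f ∈ PieceVertex.sector x.2.2)
      ?_ ?_ ?_ ?_
    · rintro ⟨i, x, y⟩ ⟨h, rfl, rfl⟩
      obtain ⟨⟨f, hf, h⟩, -⟩ := (piece_boundary_adj_iff ho hc hΓ).1 h
      exact ⟨f, hf, h⟩
    · intro f hf
      obtain ⟨x, rfl, hx⟩ := PieceVertex.exists_of_mem_verts (rfl : pieceOf Γ f = _)
        (SimpleGraph.Subgraph.Adj.fst_mem hf)
      obtain ⟨y, rfl, hy⟩ := PieceVertex.exists_of_mem_verts (rfl : pieceOf Γ f = _)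
        (SimpleGraph.Subgraph.Adj.snd_mem hf)
      exact ⟨⟨_, x, y⟩, ⟨(piece_boundary_adj_iff ho hc hΓ).2 ⟨⟨f, hf, hx, hy⟩, hcut⟩, rfl, rfl⟩,
        hx, hy⟩
    · rintro ⟨i, x, y⟩ ⟨-, rfl, rfl⟩ f hf g hg hfx hgx
      exact ho.face_eq_of_mem_sector hc hΓ hcut hf hg hfx.1 hgx.1
    · rintro f - ⟨i, x, y⟩ ⟨-, hx, hy⟩ ⟨j, x', y'⟩ ⟨-, hx', hy'⟩ hf hf'
      obtain rfl := (PieceVertex.pieceOf_eq x hf.1).symm.trans (PieceVertex.pieceOf_eq x' hf'.1)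
      exact congrArg (Sigma.mk i) (Prod.ext
        (PieceVertex.eq_of_mem (Eq.trans hx (Eq.symm hx')) hf.1 hf'.1)
        (PieceVertex.eq_of_mem (Eq.trans hy (Eq.symm hy')) hf.2 hf'.2))
  vertex_on v hv := by
    -- Each sector is matched with its one outgoing cut edge.
    refine ncard_eq_of_rel (fun x w => ∃ f ∈ PieceVertex.sector x.2, o f v w) ?_ ?_ ?_ ?_
    · rintro ⟨i, x⟩ rfl
      obtain ⟨f, hf, w, hw, hcut⟩ := PieceVertex.exists_out_cut ho hc hΓ x hv
      exact ⟨w, hcut, f, hf, hw⟩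
    · intro w hw
      obtain ⟨f, hf⟩ := ho.exists_face hc (Γ.adj_sub hw)
      obtain ⟨x, hx, hfx⟩ := exists_sigma_of_mem_verts (Γ := Γ) (ho.adj hf).fst_mem
      exact ⟨x, hx, f, hfx, hf⟩
    · rintro ⟨i, x⟩ rfl w hw w' hw' ⟨f, hf, hfw⟩ ⟨g, hg, hgw⟩
      obtain rfl := ho.out_cut_unique ((PieceVertex.mem_sector_iff x hf).1 hg) hfw hw hgw hw'
      exact ho.eq_of_out hfw hgw
    · rintro w - x hx x' hx' ⟨f, hf, hfw⟩ ⟨g, hg, hgw⟩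
      obtain rfl := ho.face_eq hfw hgw
      exact PieceVertex.sigma_eq_of_mem (Eq.trans hx (Eq.symm hx')) hf hg

/-! ### Injectivity on boundary curves -/

section

variable {i : PieceIndex Γ}

/-- `xy` is a boundary edge of a piece, directed from `x` to `y` by the face that it lies on. -/
def BoundaryStep (o : S.F → S.V → S.V → Prop) (x y : PieceVertex Γ i) : Prop :=
  Γ.Adj x.base y.base ∧ ∃ f ∈ x.sector, f ∈ y.sector ∧ o f x.base y.base

theorem boundaryStep_or (ho : S.IsOrientation o) {x y : PieceVertex Γ i}
    (h : (pieceGraph Γ i).Adj x y) (hcut : Γ.Adj x.base y.base) :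
    BoundaryStep o x y ∨ BoundaryStep o y x := by
  obtain ⟨f, hf, hx, hy⟩ := h
  exact ((ho.adj_iff _ _ _).1 hf).imp (fun h => ⟨hcut, f, hx, hy, h⟩)
    fun h => ⟨hcut.symm, f, hy, hx, h⟩

theorem boundaryStep_right_unique (ho : S.IsOrientation o) {x y z : PieceVertex Γ i}
    (hy : BoundaryStep o x y) (hz : BoundaryStep o x z) : y = z := by
  obtain ⟨hy, f, hfx, hfy, hf⟩ := hy
  obtain ⟨hz, g, hgx, hgz, hg⟩ := hz
  obtain rfl := ho.out_cut_unique ((x.mem_sector_iff hfx).1 hgx) hf hy hg hz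
  exact PieceVertex.eq_of_mem (ho.eq_of_out hf hg) hfy hgz

theorem boundaryStep_left_unique (ho : S.IsOrientation o) {x y z : PieceVertex Γ i}
    (hy : BoundaryStep o y x) (hz : BoundaryStep o z x) : y = z := by
  have hrev : ∀ {y}, BoundaryStep o y x → BoundaryStep (fun f v w => o f w v) x y :=
    fun ⟨h, f, h1, h2, hf⟩ => ⟨h.symm, f, h2, h1, hf⟩
  exact boundaryStep_right_unique ho.reverse (hrev hy) (hrev hz)

/-- Boundary steps are unique forwards and backwards, so a change of direction along an undirected
path only retraces it. -/
theorem exists_boundaryStep_path (ho : S.IsOrientation o) (hc : S.IsClosed)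
    (hΓ : ∀ v ∈ Γ.verts, 2 ≤ (Γ.neighborSet v).ncard) {a b : PieceVertex Γ i}
    (h : (piece Γ ho hc hΓ i).boundary.Reachable a b) :
    Relation.ReflTransGen (BoundaryStep o) a b ∨ Relation.ReflTransGen (BoundaryStep o) b a := by
  replace h := (SimpleGraph.reachable_iff_reflTransGen (G := (piece Γ ho hc hΓ i).boundary) a b).1 h
  induction h with
  | refl => exact Or.inl .refl
  | @tail b c _ hbc ih =>
    obtain ⟨hadj, hcut⟩ := (piece_boundary_adj_iff ho hc hΓ).1 hbc
    rcases boundaryStep_or ho hadj hcut with hbc | hcb <;> rcases ih with ih | ih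
    · exact Or.inl (ih.tail hbc)
    · rcases ih.cases_head with rfl | ⟨d, hd, hda⟩
      · exact Or.inl (.single hbc)
      · exact Or.inr (boundaryStep_right_unique ho hbc hd ▸ hda)
    · rcases ih.cases_tail with rfl | ⟨d, had, hd⟩
      · exact Or.inr (.single hcb)
      · exact Or.inl (boundaryStep_left_unique ho hcb hd ▸ had)
    · exact Or.inr (ih.head hcb)

/-- The boundary edges of the two sides of a curve are directed oppositely. -/
theorem base_eq_of_boundaryStep (ho : S.IsOrientation o) (hc : S.IsClosed)
    (hΓ : ∀ v ∈ Γ.verts, (Γ.neighborSet v).ncard = 2) {a b c d : PieceVertex Γ i}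
    (hab : a.base = b.base) (hne : a ≠ b) (hac : BoundaryStep o a c) (hdb : BoundaryStep o d b) :
    c.base = d.base ∧ c ≠ d := by
  have hΓ' : ∀ v ∈ Γ.verts, 2 ≤ (Γ.neighborSet v).ncard := fun v hv => (hΓ v hv).ge
  obtain ⟨hac, f, hfa, hfc, hf⟩ := hac
  obtain ⟨hdb, g, hgd, hgb, hg⟩ := hdb
  -- Of the two neighbours in `Γ`, `w` is the one by which the sector of `b` is left. Neither `c`
  -- nor `d` lies over `w`, so both lie over the other.
  obtain ⟨k, hkb, w, hk, hw⟩ := b.exists_out_cut ho hc hΓ' hdb.snd_mem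
  have hcw : c.base ≠ w := by
    rintro rfl
    rw [← hab] at hk
    obtain rfl := ho.face_eq hk hf
    exact hne (PieceVertex.eq_of_mem hab hfa hkb)
  have hdw : d.base ≠ w := by
    rintro rfl
    obtain rfl := ho.face_eq_of_mem_sector hc hΓ' hw (ho.adj hk) (ho.adj' hg) hkb hgb
    exact ho.asymm _ _ _ hk hg
  have hcd : c.base = d.base := by
    obtain ⟨p, q, -, hpq⟩ := Set.ncard_eq_two.1 (hΓ b.base hdb.snd_mem)
    have hmem : ∀ z, Γ.Adj b.base z → z = p ∨ z = q := fun z hz => by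
      have : z ∈ Γ.neighborSet b.base := hz
      rwa [hpq] at this
    have h1 := hmem _ (hab ▸ hac)
    have h2 := hmem _ hdb.symm
    have h3 := hmem _ hw
    grind
  refine ⟨hcd, ?_⟩
  rintro rfl
  rw [hab] at hf hac
  obtain rfl := ho.face_eq_of_mem_sector hc hΓ' hdb (ho.adj' hf) (ho.adj hg) hfc hgd
  exact ho.asymm _ _ _ hf hg

theorem exists_seq_of_reflTransGen {α : Type*} {r : α → α → Prop} {a b : α}
    (h : Relation.ReflTransGen r a b) :
    ∃ (n : ℕ) (x : ℕ → α), x 0 = a ∧ x n = b ∧ ∀ k < n, r (x k) (x (k + 1)) := by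
  induction h using Relation.ReflTransGen.head_induction_on with
  | refl => exact ⟨0, fun _ => b, rfl, rfl, fun k hk => absurd hk (Nat.not_lt_zero k)⟩
  | @head a c hac _ ih =>
    obtain ⟨n, x, h0, hn, hx⟩ := ih
    refine ⟨n + 1, fun k => Nat.casesOn k a x, rfl, hn, fun k hk => ?_⟩
    cases k with
    | zero =>
      change r a (x 0)
      rwa [h0]
    | succ k => exact hx k (by omega)

theorem eq_of_boundaryStep_path (ho : S.IsOrientation o) (hc : S.IsClosed)
    (hΓ : ∀ v ∈ Γ.verts, (Γ.neighborSet v).ncard = 2) {a b : PieceVertex Γ i}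
    (hpath : Relation.ReflTransGen (BoundaryStep o) a b) (hab : a.base = b.base) : a = b := by
  by_contra hne
  obtain ⟨n, x, rfl, rfl, hx⟩ := exists_seq_of_reflTransGen hpath
  have key : ∀ k l, k + l = n → k ≤ l → (x k).base = (x l).base ∧ x k ≠ x l := by
    intro k
    induction k with
    | zero =>
      rintro l hl -
      obtain rfl : l = n := by omega
      exact ⟨hab, hne⟩
    | succ k ih =>
      intro l hl hkl
      obtain ⟨h1, h2⟩ := ih (l + 1) (by omega) (by omega)
      exact base_eq_of_boundaryStep ho hc hΓ h1 h2 (hx k (by omega)) (hx l (by omega))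
  -- For even `n` the middle vertex would differ from itself; for odd `n` the middle edge would map
  -- to a loop.
  obtain ⟨m, hm⟩ | ⟨m, hm⟩ := Nat.even_or_odd n
  · exact (key m m hm.symm le_rfl).2 rfl
  · have h1 := (key m (m + 1) (by omega) (by omega)).1
    have h2 := (hx m (by omega)).1
    rw [h1] at h2
    exact h2.ne rfl

end

end DiscreteSurface

theorem lemma3p2 (S : DiscreteSurface.{u}) (g : ℕ) (hS : S.IsClosedOfGenus g)
    -- the sample points, the levels, and the values at the sample points and along the paths
    (J : Set S.V) {n : ℕ} (A : Fin n → ℝ) (hA : StrictMono A) (val : S.V → ℝ)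
    -- the paths, and the graph that they form together
    {κ : Type*} (src tgt : κ → S.V) (p : ∀ k, S.G.Walk (src k) (tgt k))
    (hp : ∀ k, IsGraduallyVariedPath A val (p k))
    (Γ : S.G.Subgraph) (hΓ : Γ = ⨆ k, (p k).toSubgraph)
    (hJ : J ⊆ Γ.verts)
    -- each path vertex has two path neighbours
    (h2 : ∀ v ∈ Γ.verts, 2 ≤ (Γ.neighborSet v).ncard) :
    ∃ (ι : Type u) (_ : Finite ι) (_ : Nonempty ι) (M : ι → DiscreteSurface.{u})
      (φ : ∀ i, (M i).V → S.V) (ψ : ∀ i, (M i).F → S.F),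
      S.IsCutAlong Γ M φ ψ ∧
      -- if there are exactly two, each boundary curve is mapped one-to-one (onto a path curve)
      ((∀ v ∈ Γ.verts, (Γ.neighborSet v).ncard = 2) →
        ∀ i a b, (M i).boundary.Reachable a b → φ i a = φ i b → a = b) := by
  obtain ⟨hc, ⟨o, h1, h2', h3, h4⟩, -⟩ := hS
  have ho : S.IsOrientation o := ⟨h1, h2', h3, h4⟩
  have := S.finite_F
  obtain ⟨f⟩ := S.nonempty_F
  refine ⟨DiscreteSurface.PieceIndex Γ, inferInstanceAs (Finite (Quot _)),
    ⟨DiscreteSurface.pieceOf Γ f⟩, DiscreteSurface.piece Γ ho hc h2, _, _,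
    DiscreteSurface.piece_isCutAlong ho hc h2, fun hΓ2 i a b hab h => ?_⟩
  rcases DiscreteSurface.exists_boundaryStep_path ho hc h2 hab with hpath | hpath
  · exact DiscreteSurface.eq_of_boundaryStep_path ho hc hΓ2 hpath h
  · exact (DiscreteSurface.eq_of_boundaryStep_path ho hc hΓ2 hpath h.symm).symm
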